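/- Let $0<q<1$. Put $(a;q)_n=\prod_{j=0}^{n-1}(1-aq^j)$ and $(a;q)_\infty=\prod_{j=0}^{\infty}(1-aq^j)$, let $\theta_q(x)=(x;q)_\infty\,(qx^{-1};q)_\infty$ for $x\in\mathbb{C}\setminus\{0\}$, and let $$A_q(z)={}_0\phi_1(-;0;q,-qz)=\sum_{n=0}^{\infty}\frac{q^{n^2}}{(q;q)_n}(-z)^n,\qquad z\in\mathbb{C},$$ be the Ramanujan entire function. Then for all $z\in\mathbb{C}\setminus\{0\}$ and $\ell\in\mathbb{Z}$ the two series below converge absolutely and $$\sum_{k=-\infty}^{\infty}z^{k}q^{k(k-1)/2}A_{q}\left(zq^{k+\ell}\right)A_{q}\left(zq^{k-\ell}\right)=(q;q)_{\infty}^{2}\,\theta_{q}(-z)\,\delta_{0,\ell},$$ $$\sum_{k=-\infty}^{\infty}(-1)^{k}q^{k(k-1)/2}A_{q}\left(zq^{k+\ell}\right)A_{q}\left(z^{-1}q^{k-\ell}\right)=0,$$ where $\delta_{0,\ell}=1$ if $\ell=0$ and $\delta_{0,\ell}=0$ otherwise. -/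

import Mathlib

namespace QSeries

noncomputable section

/-- The finite `q`-shifted factorial `(a; q)_n = ∏_{j=0}^{n-1} (1 - a q^j)`. -/
def qPoch (a q : ℂ) (n : ℕ) : ℂ := ∏ j ∈ Finset.range n, (1 - a * q ^ j)

/-- The infinite `q`-shifted factorial `(a; q)_∞ = ∏_{j=0}^∞ (1 - a q^j)`
(for `|q| < 1` the product converges absolutely). -/
def qPochInf (a q : ℂ) : ℂ := ∏' j : ℕ, (1 - a * q ^ j)

/-- The basic hypergeometric series
`₀φ₁(-; b; q, z) = ∑_{n ≥ 0} ((-1)^n q^{n(n-1)/2})^{1+s-r} z^n / ((q; q)_n (b; q)_n)`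
with `r = 0` and `s = 1`, so that the exponent `1 + s - r` is `2`. -/
def phi01 (b q z : ℂ) : ℂ :=
  ∑' n : ℕ, ((-1) ^ n * q ^ (n * (n - 1) / 2)) ^ 2 * z ^ n / (qPoch q q n * qPoch b q n)

/-- The Ramanujan entire function `A_q(z) = ₀φ₁(-; 0; q, -qz)`. -/
def ramanujanA (q z : ℂ) : ℂ := phi01 0 q (-(q * z))

/-- The theta function `θ_q(x) = (x; q)_∞ (q x⁻¹; q)_∞`, for `x ≠ 0`. -/
def theta (q x : ℂ) : ℂ := qPochInf x q * qPochInf (q * x⁻¹) q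

end

end QSeries

open Filter Topology

namespace QSeries

/-! Both series have the form `∑ₖ w^k q^(tri k) A_q(w t q^k) A_q(w t⁻¹ q^k)`. Expanding the two
Ramanujan functions with indices `m` and `n` gives the exponent `tri k + n² + m² + k(n+m) = tri
(k+n+m) + tri (m-n) + m`, so shifting `k` by `n + m` separates the triple sum into `K(t) · ∑ₖ w^k
q^(tri k)` (`hasSum_ramanujanA_mul`), with `K(t)` the sum of `kernel`.

For the first identity `w = z`, `t = q^l`: the theta series is given by the Jacobi triple product
(`tsum_theta`). Euler's expansion turns the `m`-sum in `K(q^l)` into `(q^(l+1-n); q)_∞`, which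
vanishes when `n > l`; with `K(t⁻¹) = K(t)` this leaves only `l = 0`, `n = 0`. For the second
identity `w = -1`, and the theta series itself vanishes.

`HasSum` over `ℤ` in `ℂ` already encodes absolute convergence. -/

/-- The triangular number `k (k - 1) / 2` of an integer. -/
def tri (k : ℤ) : ℤ := k * (k - 1) / 2

theorem two_mul_tri (k : ℤ) : 2 * tri k = k * (k - 1) :=
  Int.mul_ediv_cancel' (by
    have h := Int.even_mul_succ_self (k - 1)
    rw [sub_add_cancel, mul_comm] at h
    exact h.two_dvd)

theorem tri_add (a b : ℤ) : tri (a + b) = tri a + tri b + a * b := by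
  have h1 := two_mul_tri (a + b)
  have h2 := two_mul_tri a
  have h3 := two_mul_tri b
  linarith [show (a + b) * (a + b - 1) = a * (a - 1) + b * (b - 1) + 2 * (a * b) by ring]

theorem tri_zero : tri 0 = 0 := rfl

theorem tri_one : tri 1 = 0 := rfl

theorem tri_add_one (a : ℤ) : tri (a + 1) = tri a + a := by
  rw [tri_add, tri_one]; ring

theorem tri_neg (a : ℤ) : tri (-a) = tri a + a := by
  have h1 := two_mul_tri (-a)
  have h2 := two_mul_tri a
  linarith [show (-a) * (-a - 1) = a * (a - 1) + 2 * a by ring]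

/-! ### Infinite products and their zeros -/

section Basic

variable {q : ℂ}

theorem summable_norm_geometric_shift (hq : ‖q‖ < 1) (a : ℂ) :
    Summable fun j : ℕ => ‖-(a * q ^ j)‖ := by
  simp only [norm_neg, norm_mul, norm_pow]
  exact (summable_geometric_of_lt_one (norm_nonneg q) hq).mul_left _

theorem multipliable_qPoch (hq : ‖q‖ < 1) (a : ℂ) :
    Multipliable fun j : ℕ => 1 - a * q ^ j := by
  simpa only [sub_eq_add_neg] using
    multipliable_one_add_of_summable (summable_norm_geometric_shift hq a)

theorem tendsto_qPoch (hq : ‖q‖ < 1) (a : ℂ) :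
    Tendsto (qPoch a q) atTop (𝓝 (qPochInf a q)) :=
  (multipliable_qPoch hq a).tendsto_prod_tprod_nat

theorem qPoch_succ (a q : ℂ) (n : ℕ) : qPoch a q (n + 1) = qPoch a q n * (1 - a * q ^ n) :=
  Finset.prod_range_succ _ _

theorem qPoch_zero (a q : ℂ) : qPoch a q 0 = 1 := rfl

theorem qPochInf_eq_qPoch_mul (hq : ‖q‖ < 1) (a : ℂ) (n : ℕ) :
    qPochInf a q = qPoch a q n * qPochInf (a * q ^ n) q := by
  rcases eq_or_ne q 0 with rfl | hq0
  · rcases n with _ | n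
    · simp [qPoch]
    · have h1 : ∀ a : ℂ, qPochInf a 0 = 1 - a := fun a => by
        rw [qPochInf, tprod_eq_mulSingle 0 (fun j hj => by simp [hj])]; simp
      rw [h1, h1, qPoch, Finset.prod_range_succ']
      simp
  have h := tendsto_qPoch hq a
  have h2 : Tendsto (fun m => qPoch a q (n + m)) atTop (𝓝 (qPochInf a q)) :=
    h.comp (tendsto_atTop_mono (fun m => Nat.le_add_left m n) tendsto_id)
  refine tendsto_nhds_unique h2 ?_
  have h3 : ∀ m, qPoch a q (n + m) = qPoch a q n * qPoch (a * q ^ n) q m := fun m => by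
    simp only [qPoch, Finset.prod_range_add, pow_add, mul_assoc]
  simp only [h3]
  exact (tendsto_qPoch hq _).const_mul _

theorem qPochInf_eq_one_sub_mul (hq : ‖q‖ < 1) (a : ℂ) :
    qPochInf a q = (1 - a) * qPochInf (a * q) q := by
  simpa [qPoch] using qPochInf_eq_qPoch_mul hq a 1

theorem one_sub_pow_succ_ne_zero (hq : ‖q‖ < 1) (n : ℕ) : 1 - q * q ^ n ≠ 0 := by
  intro h
  have h1 : ‖q ^ (n + 1)‖ < 1 := by
    rw [norm_pow]; exact pow_lt_one₀ (norm_nonneg _) hq (Nat.succ_ne_zero n)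
  rw [pow_succ', ← sub_eq_zero.mp h, norm_one] at h1
  exact lt_irrefl _ h1

theorem qPoch_self_ne_zero (hq : ‖q‖ < 1) (n : ℕ) : qPoch q q n ≠ 0 :=
  Finset.prod_ne_zero_iff.mpr fun j _ => one_sub_pow_succ_ne_zero hq j

theorem qPochInf_self_ne_zero (hq : ‖q‖ < 1) : qPochInf q q ≠ 0 := by
  have := tprod_one_add_ne_zero_of_summable (f := fun j : ℕ => -(q * q ^ j))
    (fun j => by simpa only [sub_eq_add_neg] using one_sub_pow_succ_ne_zero hq j)
    (summable_norm_geometric_shift hq q)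
  simpa only [qPochInf, sub_eq_add_neg] using this

theorem exists_norm_inv_qPoch_le (hq : ‖q‖ < 1) : ∃ C : ℝ, ∀ n, ‖(qPoch q q n)⁻¹‖ ≤ C := by
  have h := ((tendsto_qPoch hq q).inv₀ (qPochInf_self_ne_zero hq)).norm
  obtain ⟨C, hC⟩ := h.bddAbove_range
  exact ⟨C, fun n => hC ⟨n, rfl⟩⟩

theorem qPochInf_zpow_eq_zero (hq0 : q ≠ 0) {j : ℤ} (hj : j ≤ 0) :
    qPochInf (q ^ j) q = 0 := by
  have h : 1 - q ^ j * q ^ (-j).toNat = 0 := by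
    rw [← zpow_natCast, Int.toNat_of_nonneg (by lia), ← zpow_add₀ hq0]; simp
  exact tprod_of_exists_eq_zero ⟨_, h⟩

/-! ### Summability -/

theorem summable_norm_pow_mul_tri (hq : ‖q‖ < 1) (hq0 : q ≠ 0) (c : ℂ) :
    Summable fun n : ℕ => ‖c ^ n * q ^ tri n‖ := by
  rcases eq_or_ne c 0 with rfl | hc
  · refine summable_of_ne_finset_zero (s := {0}) fun n hn => ?_
    simp [show n ≠ 0 by simpa using hn]
  refine summable_of_ratio_test_tendsto_lt_one (l := 0) zero_lt_one
    (Eventually.of_forall fun n => by simp [hc, hq0, zpow_ne_zero]) ?_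
  have h : Tendsto (fun n : ℕ => ‖c‖ * ‖q‖ ^ n) atTop (𝓝 0) := by
    simpa using (tendsto_pow_atTop_nhds_zero_of_lt_one (norm_nonneg q) hq).const_mul ‖c‖
  refine h.congr fun n => ?_
  have hq' : ‖q‖ ≠ 0 := norm_ne_zero_iff.mpr hq0
  have hc' : ‖c‖ ≠ 0 := norm_ne_zero_iff.mpr hc
  push_cast
  rw [norm_norm, norm_norm, tri_add_one, zpow_add₀ hq0, norm_mul, norm_mul, norm_mul, norm_pow,
    norm_pow, zpow_natCast, norm_pow, norm_zpow]
  have := zpow_ne_zero (tri n) hq'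
  field_simp
  ring

theorem summable_norm_zpow_mul_tri (hq : ‖q‖ < 1) (hq0 : q ≠ 0) (w : ℂ) :
    Summable fun k : ℤ => ‖w ^ k * q ^ tri k‖ := by
  refine Summable.of_nat_of_neg ?_ ?_
  · simpa using summable_norm_pow_mul_tri hq hq0 w
  · refine (summable_norm_pow_mul_tri hq hq0 (w⁻¹ * q)).congr fun n => ?_
    rw [tri_neg, zpow_add₀ hq0, zpow_neg, mul_pow, inv_pow, zpow_natCast, zpow_natCast]
    ring_nf

end Basic

/-! ### Euler's two expansions -/

section Euler

variable {q : ℂ}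

theorem tendsto_tsum_mul_pow (hq : ‖q‖ < 1) (c : ℕ → ℂ) (x : ℂ)
    (hs : Summable fun n => ‖c n * x ^ n‖) :
    Tendsto (fun k : ℕ => ∑' n, c n * (x * q ^ k) ^ n) atTop (𝓝 (c 0)) := by
  have h0 : ∑' n, c n * (0 : ℂ) ^ n = c 0 := by
    rw [tsum_eq_single 0 fun n hn => by simp [hn]]; simp
  rw [← h0]
  refine tendsto_tsum_of_dominated_convergence hs (fun n => ?_) (Eventually.of_forall fun k n => ?_)
  · refine (Tendsto.pow ?_ n).const_mul _
    simpa using (tendsto_pow_atTop_nhds_zero_of_norm_lt_one hq).const_mul x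
  · rw [norm_mul, norm_mul, norm_pow, norm_pow, norm_mul, norm_pow]
    gcongr
    exact mul_le_of_le_one_right (norm_nonneg _) (pow_le_one₀ (norm_nonneg _) hq.le)

theorem summable_mul_pow_mul (hq : ‖q‖ < 1) (c : ℕ → ℂ) (x : ℂ)
    (hs : Summable fun n => ‖c n * x ^ n‖) : Summable fun n => ‖c n * (x * q) ^ n‖ := by
  refine Summable.of_nonneg_of_le (fun _ => norm_nonneg _) (fun n => ?_) hs
  rw [norm_mul, norm_mul, norm_pow, norm_pow, norm_mul]
  gcongr
  exact mul_le_of_le_one_right (norm_nonneg _) hq.le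

/-- Replacing `x` by `xq` scales the `n`-th term by `q^n`. The resulting factor `1 - q^(n+1)`
cancels the last factor of `(q; q)_(n+1)` in both Euler series, giving their functional equations.
-/
theorem tsum_mul_pow_sub (hq : ‖q‖ < 1) (c : ℕ → ℂ) (x : ℂ)
    (hs : Summable fun n => ‖c n * x ^ n‖) :
    ∑' n, c n * x ^ n - ∑' n, c n * (x * q) ^ n =
      x * ∑' n, c (n + 1) * (1 - q * q ^ n) * x ^ n := by
  have h1 := hs.of_norm
  have h2 := (summable_mul_pow_mul hq c x hs).of_norm
  rw [← h1.tsum_sub h2, (h1.sub h2).tsum_eq_zero_add, ← tsum_mul_left]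
  simp only [pow_zero, sub_self, zero_add]
  refine tsum_congr fun n => ?_
  rw [mul_pow]; ring

theorem summable_norm_euler (hq : ‖q‖ < 1) (hq0 : q ≠ 0) (x : ℂ) :
    Summable fun n : ℕ => ‖(-1) ^ n * q ^ tri n * (qPoch q q n)⁻¹ * x ^ n‖ := by
  obtain ⟨C, hC⟩ := exists_norm_inv_qPoch_le hq
  refine Summable.of_nonneg_of_le (fun _ => norm_nonneg _) (fun n => ?_)
    ((summable_norm_pow_mul_tri hq hq0 x).mul_right C)
  simp only [norm_mul, norm_pow, norm_neg, norm_one, one_pow, one_mul]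
  calc _ = ‖x‖ ^ n * ‖q ^ tri n‖ * ‖(qPoch q q n)⁻¹‖ := by ring
    _ ≤ _ := by gcongr; exact hC n

theorem tsum_euler_functional (hq : ‖q‖ < 1) (hq0 : q ≠ 0) (x : ℂ) :
    ∑' n : ℕ, (-1) ^ n * q ^ tri n * (qPoch q q n)⁻¹ * x ^ n =
      (1 - x) * ∑' n : ℕ, (-1) ^ n * q ^ tri n * (qPoch q q n)⁻¹ * (x * q) ^ n := by
  have h := tsum_mul_pow_sub hq (fun n : ℕ => (-1) ^ n * q ^ tri n * (qPoch q q n)⁻¹) x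
    (summable_norm_euler hq hq0 x)
  have h2 : ∑' n : ℕ, (-1) ^ (n + 1) * q ^ tri ((n + 1 : ℕ) : ℤ) * (qPoch q q (n + 1))⁻¹ *
      (1 - q * q ^ n) * x ^ n =
      -∑' n : ℕ, (-1) ^ n * q ^ tri n * (qPoch q q n)⁻¹ * (x * q) ^ n := by
    rw [← tsum_neg]
    refine tsum_congr fun n => ?_
    have := mul_inv_cancel₀ (one_sub_pow_succ_ne_zero hq n)
    push_cast
    rw [tri_add_one, zpow_add₀ hq0, zpow_natCast, qPoch_succ, mul_pow, mul_inv]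
    linear_combination (-((-1) ^ n * q ^ tri n * (qPoch q q n)⁻¹ * x ^ n * q ^ n)) * this
  rw [h2] at h
  linear_combination h

/-- Euler's expansion of `(x; q)_∞`. -/
theorem hasSum_euler (hq : ‖q‖ < 1) (hq0 : q ≠ 0) (x : ℂ) :
    HasSum (fun n : ℕ => (-1) ^ n * q ^ tri n * (qPoch q q n)⁻¹ * x ^ n) (qPochInf x q) := by
  have hs := summable_norm_euler hq hq0 x
  refine hs.of_norm.hasSum_iff.mpr ?_
  have hit : ∀ k : ℕ, ∑' n : ℕ, (-1) ^ n * q ^ tri n * (qPoch q q n)⁻¹ * x ^ n =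
      qPoch x q k * ∑' n : ℕ, (-1) ^ n * q ^ tri n * (qPoch q q n)⁻¹ * (x * q ^ k) ^ n := by
    intro k
    induction k with
    | zero => simp [qPoch_zero]
    | succ k ih =>
      rw [ih, tsum_euler_functional hq hq0 (x * q ^ k), qPoch_succ, pow_succ]
      simp only [mul_assoc]
  have ht := (tendsto_qPoch hq x).mul
    (tendsto_tsum_mul_pow hq (fun n : ℕ => (-1) ^ n * q ^ tri n * (qPoch q q n)⁻¹) x hs)
  simp only [← hit] at ht
  simpa [tri_zero, qPoch_zero] using tendsto_nhds_unique tendsto_const_nhds ht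

theorem summable_norm_inv_qPoch_mul_pow (hq : ‖q‖ < 1) {x : ℂ} (hx : ‖x‖ < 1) :
    Summable fun n : ℕ => ‖(qPoch q q n)⁻¹ * x ^ n‖ := by
  obtain ⟨C, hC⟩ := exists_norm_inv_qPoch_le hq
  refine Summable.of_nonneg_of_le (fun _ => norm_nonneg _) (fun n => ?_)
    ((summable_geometric_of_lt_one (norm_nonneg x) hx).mul_left C)
  rw [norm_mul, norm_pow]
  gcongr
  exact hC n

/-- Euler's expansion of `1 / (x; q)_∞`. -/
theorem qPochInf_mul_tsum_inv_qPoch (hq : ‖q‖ < 1) {x : ℂ} (hx : ‖x‖ < 1) :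
    qPochInf x q * ∑' n : ℕ, (qPoch q q n)⁻¹ * x ^ n = 1 := by
  have hs := summable_norm_inv_qPoch_mul_pow hq hx
  have hfun : ∀ y : ℂ, ‖y‖ < 1 → (1 - y) * ∑' n : ℕ, (qPoch q q n)⁻¹ * y ^ n =
      ∑' n : ℕ, (qPoch q q n)⁻¹ * (y * q) ^ n := by
    intro y hy
    have h := tsum_mul_pow_sub hq (fun n : ℕ => (qPoch q q n)⁻¹) y
      (summable_norm_inv_qPoch_mul_pow hq hy)
    have h2 : ∑' n : ℕ, (qPoch q q (n + 1))⁻¹ * (1 - q * q ^ n) * y ^ n =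
        ∑' n : ℕ, (qPoch q q n)⁻¹ * y ^ n := by
      refine tsum_congr fun n => ?_
      have := one_sub_pow_succ_ne_zero hq n
      rw [qPoch_succ, mul_inv]
      field_simp
    rw [h2] at h
    linear_combination h
  have hit : ∀ k : ℕ, qPoch x q k * ∑' n : ℕ, (qPoch q q n)⁻¹ * x ^ n =
      ∑' n : ℕ, (qPoch q q n)⁻¹ * (x * q ^ k) ^ n := by
    intro k
    induction k with
    | zero => simp [qPoch_zero]
    | succ k ih =>
      have hk : ‖x * q ^ k‖ < 1 := by
        rw [norm_mul, norm_pow]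
        exact (mul_le_of_le_one_right (norm_nonneg _)
          (pow_le_one₀ (norm_nonneg _) hq.le)).trans_lt hx
      rw [qPoch_succ, mul_right_comm, ih, mul_comm, hfun _ hk, pow_succ]
      simp only [mul_assoc]
  have ht := tendsto_tsum_mul_pow hq (fun n : ℕ => (qPoch q q n)⁻¹) x hs
  simp only [← hit] at ht
  simpa [qPoch_zero] using
    tendsto_nhds_unique ((tendsto_qPoch hq x).mul_const _) ht

end Euler

end QSeries

namespace QSeries

/-! ### The Jacobi triple product -/

section Theta

variable {q : ℂ}

/-- Absolute convergence allows the product of two sums to be reindexed by `(k, i) ↦ (i, k + σ i)`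
and summed over `i` first. Used for both the triple product and the main expansion. -/
theorem hasSum_shear {ι : Type*} (σ : ι → ℤ) {h : ι → ℂ} {g : ℤ → ℂ} {F : ℤ → ℂ}
    (hh : Summable fun i => ‖h i‖) (hg : Summable fun k => ‖g k‖)
    (hF : ∀ k, HasSum (fun i => h i * g (k + σ i)) (F k)) :
    HasSum F ((∑' i, h i) * ∑' k, g k) := by
  have h1 : HasSum (fun p : ι × ℤ => h p.1 * g p.2) ((∑' i, h i) * ∑' k, g k) :=
    hh.of_norm.hasSum.mul hg.of_norm.hasSum (summable_mul_of_summable_norm hh hg)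
  let e : ℤ × ι ≃ ι × ℤ := (Equiv.prodComm ℤ ι).trans
    (Equiv.prodShear (Equiv.refl ι) fun i => Equiv.addRight (σ i))
  exact (e.hasSum_iff.mpr h1).prod_fiberwise hF

theorem qPochInf_zpow_add_one (hq : ‖q‖ < 1) (n : ℕ) :
    qPochInf (q ^ ((n : ℤ) + 1)) q = qPochInf q q * (qPoch q q n)⁻¹ := by
  have h := qPoch_self_ne_zero hq n
  rw [qPochInf_eq_qPoch_mul hq q n]
  field_simp
  norm_cast
  rw [pow_succ']

theorem hasSum_zpow_mul_qPochInf (hq : ‖q‖ < 1) (hq0 : q ≠ 0) (z : ℂ) :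
    HasSum (fun k : ℤ => z ^ k * q ^ tri k * qPochInf (q ^ (k + 1)) q)
      (qPochInf q q * qPochInf (-z) q) := by
  refine (Function.Injective.hasSum_iff Nat.cast_injective fun k hk => ?_).mp
    (((hasSum_euler hq hq0 (-z)).mul_left (qPochInf q q)).congr_fun fun n => ?_)
  · have hk' : k < 0 := by
      by_contra hk0
      exact hk ⟨k.toNat, Int.toNat_of_nonneg (by lia)⟩
    rw [qPochInf_zpow_eq_zero hq0 (by lia), mul_zero]
  · have h1 : ((-1 : ℂ) ^ n) * (-1) ^ n = 1 := by rw [← mul_pow]; simp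
    rw [Function.comp_apply, qPochInf_zpow_add_one hq, neg_pow z, zpow_natCast]
    linear_combination (-(qPochInf q q * (qPoch q q n)⁻¹ * z ^ n * q ^ tri n)) * h1

theorem tsum_theta_of_norm_lt (hq : ‖q‖ < 1) (hq0 : q ≠ 0) {z : ℂ} (hz : ‖q‖ < ‖z‖) :
    ∑' k : ℤ, z ^ k * q ^ tri k = qPochInf q q * theta q (-z) := by
  have hz0 : z ≠ 0 := norm_pos_iff.mp ((norm_nonneg q).trans_lt hz)
  have hx : ‖q * (-z)⁻¹‖ < 1 := by
    rw [norm_mul, norm_inv, norm_neg, ← div_eq_mul_inv]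
    exact (div_lt_one (norm_pos_iff.mpr hz0)).mpr hz
  -- Multiplying the theta series by the expansion of `1 / (-q/z; q)_∞` and collecting by `k` gives
  -- Euler's series for `(q^(k+1); q)_∞`.
  have h := hasSum_shear (fun m : ℕ => (m : ℤ))
    (F := fun k : ℤ => z ^ k * q ^ tri k * qPochInf (q ^ (k + 1)) q)
    (summable_norm_inv_qPoch_mul_pow hq hx) (summable_norm_zpow_mul_tri hq hq0 z) fun k => by
      refine ((hasSum_euler hq hq0 (q ^ (k + 1))).mul_left (z ^ k * q ^ tri k)).congr_fun
        fun m => ?_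
      rw [tri_add, zpow_add₀ hz0, zpow_add₀ hq0, zpow_add₀ hq0, zpow_add₀ hq0, zpow_one,
        zpow_natCast, zpow_mul, zpow_natCast, inv_neg, mul_pow, mul_pow, neg_pow, inv_pow]
      have := pow_ne_zero m hz0
      field_simp
  have h2 := h.unique (hasSum_zpow_mul_qPochInf hq hq0 z)
  have h3 := qPochInf_mul_tsum_inv_qPoch hq hx
  rw [theta]
  linear_combination qPochInf (q * (-z)⁻¹) q * h2 - (∑' k : ℤ, z ^ k * q ^ tri k) * h3

theorem tsum_theta_mul (hq0 : q ≠ 0) {w : ℂ} (hw : w ≠ 0) :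
    w * ∑' k : ℤ, (w * q) ^ k * q ^ tri k = ∑' k : ℤ, w ^ k * q ^ tri k := by
  rw [← tsum_mul_left, ← (Equiv.addRight (1 : ℤ)).tsum_eq fun k : ℤ => w ^ k * q ^ tri k]
  refine tsum_congr fun k => ?_
  rw [Equiv.coe_addRight, tri_add_one, zpow_add₀ hq0, zpow_add_one₀ hw, mul_zpow]
  ring

theorem theta_neg_mul (hq : ‖q‖ < 1) (hq0 : q ≠ 0) {w : ℂ} (hw : w ≠ 0) :
    w * theta q (-(w * q)) = theta q (-w) := by
  have h1 : q * (-(w * q))⁻¹ = -w⁻¹ := by field_simp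
  have h2 : -w⁻¹ * q = q * (-w)⁻¹ := by field_simp
  rw [theta, theta, h1, qPochInf_eq_one_sub_mul hq (-w⁻¹), qPochInf_eq_one_sub_mul hq (-w), h2,
    neg_mul]
  field_simp
  ring

/-- The Jacobi triple product identity. -/
theorem tsum_theta (hq : ‖q‖ < 1) (hq0 : q ≠ 0) {z : ℂ} (hz : z ≠ 0) :
    ∑' k : ℤ, z ^ k * q ^ tri k = qPochInf q q * theta q (-z) := by
  -- Induction over the annuli `|q|^(n+1) < |z|`: both sides satisfy `f(w) = w f(wq)`, which carries
  -- the identity from `z/q` to `z`.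
  obtain ⟨n, hn⟩ := exists_pow_lt_of_lt_one (norm_pos_iff.mpr hz) hq
  replace hn : ‖q‖ ^ (n + 1) < ‖z‖ :=
    (pow_le_pow_of_le_one (norm_nonneg _) hq.le (Nat.le_succ n)).trans_lt hn
  induction n generalizing z with
  | zero => exact tsum_theta_of_norm_lt hq hq0 (by simpa using hn)
  | succ n ih =>
    have hw : z * q⁻¹ ≠ 0 := mul_ne_zero hz (inv_ne_zero hq0)
    have hzq : z = z * q⁻¹ * q := by field_simp
    have hi := ih hw (by
      rw [norm_mul, norm_inv, ← div_eq_mul_inv, lt_div_iff₀ (norm_pos_iff.mpr hq0), ← pow_succ]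
      exact hn)
    have h1 := tsum_theta_mul hq0 hw
    have h2 := theta_neg_mul hq hq0 hw
    rw [← hzq] at h1 h2
    apply mul_left_cancel₀ hw
    rw [h1, hi, ← h2]
    ring

theorem tsum_theta_neg_one (q : ℂ) : ∑' k : ℤ, (-1 : ℂ) ^ k * q ^ tri k = 0 := by
  have h : ∑' k : ℤ, (-1 : ℂ) ^ k * q ^ tri k = -∑' k : ℤ, (-1 : ℂ) ^ k * q ^ tri k := by
    -- The reflection `k ↦ 1 - k` fixes `tri k` and flips the sign.
    nth_rewrite 1 [← (Equiv.subLeft (1 : ℤ)).tsum_eq]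
    rw [← tsum_neg]
    refine tsum_congr fun k => ?_
    have h1 : tri (1 - k) = tri k := by
      rw [sub_eq_add_neg, add_comm, tri_add_one, tri_neg]; ring
    have h2 : ((-1 : ℂ) ^ k)⁻¹ = (-1) ^ k := by rw [← inv_zpow]; norm_num
    rw [Equiv.subLeft_apply, h1, zpow_sub₀ (by norm_num), zpow_one, div_eq_mul_inv, h2]
    ring
  exact self_eq_neg.mp h

end Theta

/-! ### Products of Ramanujan functions and the kernel sum -/

section Ramanujan

variable {q : ℂ}

theorem tri_natCast (n : ℕ) : tri n = (n.choose 2 : ℕ) := by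
  induction n with
  | zero => rfl
  | succ n ih =>
    rw [Nat.cast_succ, tri_add_one, ih, Nat.choose_succ_succ' n 1, Nat.choose_one_right]
    push_cast; ring

theorem summable_norm_ramanujanA (hq : ‖q‖ < 1) (hq0 : q ≠ 0) (x : ℂ) :
    Summable fun n : ℕ => ‖(-1) ^ n * q ^ n ^ 2 * (qPoch q q n)⁻¹ * x ^ n‖ := by
  refine Summable.of_nonneg_of_le (fun _ => norm_nonneg _) (fun n => ?_)
    (summable_norm_euler hq hq0 x)
  rw [tri_natCast, zpow_natCast]
  simp only [norm_mul, norm_pow]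
  gcongr ?_ * ?_ * ?_ * ?_
  refine pow_le_pow_of_le_one (norm_nonneg _) hq.le ?_
  rw [Nat.choose_two_right, sq]
  exact (Nat.div_le_self _ _).trans (Nat.mul_le_mul_left n (Nat.sub_le n 1))

theorem hasSum_ramanujanA (hq : ‖q‖ < 1) (hq0 : q ≠ 0) (x : ℂ) :
    HasSum (fun n : ℕ => (-1) ^ n * q ^ n ^ 2 * (qPoch q q n)⁻¹ * x ^ n) (ramanujanA q x) := by
  have h := (summable_norm_ramanujanA hq hq0 x).of_norm.hasSum
  suffices heq : ramanujanA q x =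
      ∑' n : ℕ, (-1) ^ n * q ^ n ^ 2 * (qPoch q q n)⁻¹ * x ^ n by rwa [heq]
  refine tsum_congr fun n => ?_
  have h0 : qPoch 0 q n = 1 := by simp [qPoch]
  have h1 : ((-1 : ℂ) ^ n) ^ 2 = 1 := by rw [← pow_mul, mul_comm, pow_mul]; simp
  have h2 : q ^ n ^ 2 = (q ^ (n * (n - 1) / 2)) ^ 2 * q ^ n := by
    rw [← pow_mul, ← pow_add, Nat.div_mul_cancel (Nat.even_mul_pred_self n).two_dvd]
    congr 1
    rcases n with _ | n
    · rfl
    · rw [Nat.add_sub_cancel]; ring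
  rw [h0, h2, mul_pow, h1, neg_pow, mul_pow]
  ring

/-- The coefficient kernel arising from multiplying two Ramanujan series. -/
noncomputable def kernel (q t : ℂ) (p : ℕ × ℕ) : ℂ :=
  (-1) ^ p.1 * (-1) ^ p.2 * (qPoch q q p.1)⁻¹ * (qPoch q q p.2)⁻¹ *
    (t ^ ((p.2 : ℤ) - p.1) * q ^ tri ((p.2 : ℤ) - p.1)) * q ^ p.2

theorem summable_norm_kernel (hq : ‖q‖ < 1) (hq0 : q ≠ 0) (t : ℂ) :
    Summable fun p => ‖kernel q t p‖ := by
  obtain ⟨C, hC⟩ := exists_norm_inv_qPoch_le hq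
  have hC0 : 0 ≤ C := (norm_nonneg _).trans (hC 0)
  have h := summable_mul_of_summable_norm (summable_norm_zpow_mul_tri hq hq0 t)
    (g := fun m : ℕ => q ^ m) (by
      simpa only [norm_pow] using summable_geometric_of_lt_one (norm_nonneg q) hq)
  -- In the coordinates `(m - n, m)` the kernel is dominated by a theta series times a geometric
  -- series.
  have hinj : Function.Injective fun p : ℕ × ℕ => ((p.2 : ℤ) - p.1, p.2) := by
    rintro ⟨a, b⟩ ⟨c, d⟩ h
    simp only [Prod.mk.injEq] at h ⊢
    lia
  refine Summable.of_nonneg_of_le (fun _ => norm_nonneg _) (fun p => ?_)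
    ((h.norm.comp_injective hinj).mul_left (C * C))
  rw [kernel, mul_assoc _ _ (q ^ p.2), norm_mul, norm_mul, norm_mul]
  refine mul_le_mul_of_nonneg_right (mul_le_mul ?_ (hC _) (norm_nonneg _) hC0) (norm_nonneg _)
  simpa using hC p.1

theorem hasSum_ramanujanA_mul (hq : ‖q‖ < 1) (hq0 : q ≠ 0) {w t : ℂ} (hw : w ≠ 0) (ht : t ≠ 0) :
    HasSum (fun k : ℤ => w ^ k * q ^ tri k * ramanujanA q (w * t * q ^ k) *
        ramanujanA q (w * t⁻¹ * q ^ k))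
      ((∑' p, kernel q t p) * ∑' k : ℤ, w ^ k * q ^ tri k) := by
  refine hasSum_shear (fun p : ℕ × ℕ => (p.1 : ℤ) + p.2) (summable_norm_kernel hq hq0 t)
    (summable_norm_zpow_mul_tri hq hq0 w) fun k => ?_
  have hs := summable_mul_of_summable_norm (summable_norm_ramanujanA hq hq0 (w * t⁻¹ * q ^ k))
    (summable_norm_ramanujanA hq hq0 (w * t * q ^ k))
  have h := ((hasSum_ramanujanA hq hq0 (w * t⁻¹ * q ^ k)).mul
    (hasSum_ramanujanA hq hq0 (w * t * q ^ k)) hs).mul_left (w ^ k * q ^ tri k)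
  rw [mul_assoc (w ^ k * q ^ tri k), mul_comm (ramanujanA q _)]
  refine h.congr_fun fun ⟨n, m⟩ => ?_
  have hexp : q ^ tri ((m : ℤ) - n) * q ^ m * q ^ tri (k + ((n : ℤ) + m)) =
      q ^ tri k * q ^ n ^ 2 * q ^ m ^ 2 * (q ^ k) ^ n * (q ^ k) ^ m := by
    simp only [← zpow_natCast, ← zpow_mul, ← zpow_add₀ hq0]
    congr 1
    have h1 := two_mul_tri ((m : ℤ) - n)
    have h2 := two_mul_tri (k + ((n : ℤ) + m))
    have h3 := two_mul_tri k
    push_cast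
    linarith [show ((m : ℤ) - n) * (m - n - 1) + (k + (n + m)) * (k + (n + m) - 1) + 2 * m =
      k * (k - 1) + 2 * n ^ 2 + 2 * m ^ 2 + 2 * (k * n) + 2 * (k * m) by ring]
  simp only [kernel, zpow_sub₀ ht, zpow_add₀ hw, zpow_natCast, mul_pow, inv_pow,
    div_eq_mul_inv]
  linear_combination ((-1) ^ n * (-1) ^ m * (qPoch q q n)⁻¹ * (qPoch q q m)⁻¹ *
    (t ^ m * (t ^ n)⁻¹) * (w ^ k * (w ^ n * w ^ m))) * hexp

/-- Swapping `n` and `m` works because `tri (-a) = tri a + a` absorbs the asymmetric factor `q^m`.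
-/
theorem tsum_kernel_inv (hq0 : q ≠ 0) (t : ℂ) : ∑' p, kernel q t⁻¹ p = ∑' p, kernel q t p := by
  rw [← (Equiv.prodComm ℕ ℕ).tsum_eq]
  refine tsum_congr fun p => ?_
  have hexp : q ^ tri ((p.1 : ℤ) - p.2) * q ^ p.1 = q ^ tri ((p.2 : ℤ) - p.1) * q ^ p.2 := by
    rw [← neg_sub (p.2 : ℤ), tri_neg]
    simp only [← zpow_natCast, ← zpow_add₀ hq0]
    congr 1
    ring
  simp only [kernel, Equiv.prodComm_apply, Prod.fst_swap, Prod.snd_swap]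
  rw [inv_zpow, ← zpow_neg, neg_sub]
  linear_combination ((-1) ^ p.2 * (-1) ^ p.1 * (qPoch q q p.2)⁻¹ * (qPoch q q p.1)⁻¹ *
    t ^ ((p.2 : ℤ) - p.1)) * hexp

theorem tsum_kernel (hq : ‖q‖ < 1) (hq0 : q ≠ 0) {t : ℂ} (ht : t ≠ 0) :
    ∑' p, kernel q t p = ∑' n : ℕ, (-1) ^ n * (qPoch q q n)⁻¹ * (t ^ n)⁻¹ * q ^ (tri n + n) *
      qPochInf (t * q ^ (1 - n : ℤ)) q := by
  refine ((summable_norm_kernel hq hq0 t).of_norm.hasSum.prod_fiberwise fun n => ?_).tsum_eq.symm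
  refine ((hasSum_euler hq hq0 (t * q ^ (1 - n : ℤ))).mul_left
    ((-1) ^ n * (qPoch q q n)⁻¹ * (t ^ n)⁻¹ * q ^ (tri n + n))).congr_fun fun m => ?_
  have hexp : q ^ tri ((m : ℤ) - n) * q ^ m =
      q ^ (tri n + n) * q ^ tri m * (q ^ (1 - n : ℤ)) ^ m := by
    simp only [← zpow_natCast, ← zpow_mul, ← zpow_add₀ hq0]
    congr 1
    rw [sub_eq_add_neg, tri_add, tri_neg]
    ring
  simp only [kernel, zpow_sub₀ ht, zpow_natCast, mul_pow, div_eq_mul_inv]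
  linear_combination ((-1) ^ n * (-1) ^ m * (qPoch q q n)⁻¹ * (qPoch q q m)⁻¹ *
    (t ^ m * (t ^ n)⁻¹)) * hexp

theorem tsum_kernel_zpow_of_neg (hq : ‖q‖ < 1) (hq0 : q ≠ 0) {l : ℤ} (hl : l < 0) :
    ∑' p, kernel q (q ^ l) p = 0 := by
  rw [tsum_kernel hq hq0 (zpow_ne_zero l hq0)]
  refine (tsum_congr fun n => ?_).trans tsum_zero
  rw [← zpow_add₀ hq0, qPochInf_zpow_eq_zero hq0 (by lia), mul_zero]

theorem tsum_kernel_zpow (hq : ‖q‖ < 1) (hq0 : q ≠ 0) (l : ℤ) :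
    ∑' p, kernel q (q ^ l) p = if l = 0 then qPochInf q q else 0 := by
  rcases lt_trichotomy l 0 with hl | rfl | hl
  · rw [tsum_kernel_zpow_of_neg hq hq0 hl, if_neg hl.ne]
  · rw [zpow_zero, if_pos rfl, tsum_kernel hq hq0 one_ne_zero, tsum_eq_single 0 fun n hn => ?_]
    · simp [qPoch_zero, tri_zero]
    · rw [one_mul, qPochInf_zpow_eq_zero hq0 (by lia), mul_zero]
  · rw [← tsum_kernel_inv hq0, ← zpow_neg, tsum_kernel_zpow_of_neg hq hq0 (by lia), if_neg hl.ne']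

end Ramanujan

end QSeries

theorem mainTheorem10 (q : ℝ) (hq0 : 0 < q) (hq1 : q < 1) (z : ℂ) (hz : z ≠ 0) (l : ℤ) :
    HasSum
      (fun k : ℤ => z ^ k * (q : ℂ) ^ (k * (k - 1) / 2) *
        QSeries.ramanujanA q (z * (q : ℂ) ^ (k + l)) *
        QSeries.ramanujanA q (z * (q : ℂ) ^ (k - l)))
      (QSeries.qPochInf q q ^ 2 * QSeries.theta q (-z) * (if l = 0 then 1 else 0)) ∧
    HasSum
      (fun k : ℤ => (-1 : ℂ) ^ k * (q : ℂ) ^ (k * (k - 1) / 2) *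
        QSeries.ramanujanA q (z * (q : ℂ) ^ (k + l)) *
        QSeries.ramanujanA q (z⁻¹ * (q : ℂ) ^ (k - l)))
      0 := by
  have hqc : (q : ℂ) ≠ 0 := Complex.ofReal_ne_zero.mpr hq0.ne'
  have hqn : ‖(q : ℂ)‖ < 1 := by rwa [Complex.norm_real, Real.norm_of_nonneg hq0.le]
  have hql : (q : ℂ) ^ l ≠ 0 := zpow_ne_zero l hqc
  constructor
  · have h := QSeries.hasSum_ramanujanA_mul hqn hqc hz hql
    rw [QSeries.tsum_kernel_zpow hqn hqc, QSeries.tsum_theta hqn hqc hz] at h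
    convert h using 1
    · funext k
      rw [zpow_add₀ hqc, zpow_sub₀ hqc, div_eq_mul_inv, mul_comm _ ((q : ℂ) ^ l),
        mul_comm _ ((q : ℂ) ^ l)⁻¹, ← mul_assoc, ← mul_assoc, QSeries.tri]
    · split_ifs <;> ring
  -- The sign in `t` compensates `w = -1`: `w t = z q^l` and `w t⁻¹ = z⁻¹ q^(-l)`.
  · have h := QSeries.hasSum_ramanujanA_mul hqn hqc (w := -1) (t := -(z * (q : ℂ) ^ l))
      (by norm_num) (neg_ne_zero.mpr (mul_ne_zero hz hql))
    rw [QSeries.tsum_theta_neg_one, mul_zero] at h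
    convert h using 1
    funext k
    have h1 : z * (q : ℂ) ^ (k + l) = -1 * -(z * (q : ℂ) ^ l) * (q : ℂ) ^ k := by
      rw [zpow_add₀ hqc]; ring
    have h2 : z⁻¹ * (q : ℂ) ^ (k - l) = -1 * (-(z * (q : ℂ) ^ l))⁻¹ * (q : ℂ) ^ k := by
      rw [zpow_sub₀ hqc, inv_neg, mul_inv]; ring
    rw [h1, h2, QSeries.tri]
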